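/- Let $n\ge 2$ and let $\mathscr{C}_n$ be the set of all $n$-cycles in the symmetric group on $\{1,\dots,n\}$. For a permutation $\nu$ of $\{1,\dots,n\}$ let its degree (cyclic descent number) be $\deg(\nu)=\#\{i\in\{1,\dots,n\} : \nu(i)>\nu(i+1)\}$, where $i$ is taken modulo $n$, so that $\nu(n+1)=\nu(1)$. Let $N_{n,d}$ be the number of $\nu\in\mathscr{C}_n$ with $\deg(\nu)=d$. Then the mean $\mu_n$ and the variance $\sigma_n^2$ of $\deg(\nu)$, for $\nu$ chosen from $\mathscr{C}_n$ with respect to the uniform probability measure, are $$\mu_n=\frac{1}{(n-1)!}\sum_{d=1}^{n-2} d\,N_{n,d}=\frac n2-\frac1{n-1}\qquad(n\ge 3),$$ $$\sigma_n^2=\frac{1}{(n-1)!}\sum_{d=1}^{n-2}(d-\mu_n)^2N_{n,d}=\frac n{12}+\frac{n}{(n-1)^2(n-2)}\qquad(n\ge 5).$$ -/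

import Mathlib

namespace CycleDegree

open Classical in
/-- The set of all `n`-cycles among the permutations of an `n`-element set, for `n ≥ 2`: the
permutations that are a single cycle moving every point. -/
noncomputable def nCycles (n : ℕ) : Finset (Equiv.Perm (Fin n)) :=
  {ν : Equiv.Perm (Fin n) | ν.IsCycle ∧ ν.support = Finset.univ}

/-- The degree (cyclic descent number) of `ν`: the number of `i` with `ν i > ν (i + 1)`, where `i`
is taken modulo `n`. The permutation `finRotate n` is `i ↦ i + 1` modulo `n`. -/
def degree {n : ℕ} (ν : Equiv.Perm (Fin n)) : ℕ :=
  Finset.card {i : Fin n | ν i > ν (finRotate n i)}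

/-- The number `N_{n,d}` of `n`-cycles of degree `d`. -/
noncomputable def N (n d : ℕ) : ℕ :=
  Finset.card {ν ∈ nCycles n | degree ν = d}

/-- The discrete σ-algebra on the finite set of permutations of `Fin n`. -/
instance permMeasurableSpace (n : ℕ) : MeasurableSpace (Equiv.Perm (Fin n)) := ⊤

/-- The uniform probability measure on the set of `n`-cycles. -/
noncomputable def uniformCycle (n : ℕ) : MeasureTheory.Measure (Equiv.Perm (Fin n)) :=
  ProbabilityTheory.uniformOn (nCycles n : Set (Equiv.Perm (Fin n)))

/-- The average `μ_n` of `d` with weights `N_{n,d} / (n-1)!`, over `1 ≤ d ≤ n - 2`. -/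
noncomputable def meanDegree (n : ℕ) : ℝ :=
  1 / ((n - 1).factorial : ℝ) * ∑ d ∈ Finset.Icc 1 (n - 2), (d : ℝ) * (N n d : ℝ)

/-- The average `σ_n²` of `(d - μ_n)²` with weights `N_{n,d} / (n-1)!`, over `1 ≤ d ≤ n - 2`. -/
noncomputable def varDegree (n : ℕ) : ℝ :=
  1 / ((n - 1).factorial : ℝ) *
    ∑ d ∈ Finset.Icc 1 (n - 2), ((d : ℝ) - meanDegree n) ^ 2 * (N n d : ℝ)

end CycleDegree

namespace CycleDegree

open Equiv Equiv.Perm Finset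

section ExtensionMatrix

variable {V : Type*} [DecidableEq V]

/-- The matrix `1 - A`, where `A` is the adjacency matrix of `p x ↦ a x` on the points `p x`. Its
determinant is `1` if this partial function has no cycle and `0` otherwise. -/
def extMatrix {k : ℕ} (p a : Fin k → V) : Matrix (Fin k) (Fin k) ℝ :=
  Matrix.of fun x y => (if x = y then 1 else 0) - if a x = p y then 1 else 0

theorem det_extMatrix_cons_self {k : ℕ} {p₀ : V} {p : Fin k → V}
    (hp : Function.Injective (Fin.cons p₀ p : Fin (k + 1) → V)) (a : Fin k → V) :
    (extMatrix (Fin.cons p₀ p : Fin (k + 1) → V) (Fin.cons p₀ a)).det = 0 := by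
  refine Matrix.det_eq_zero_of_row_eq_zero 0 fun y => ?_
  have : (p₀ = (Fin.cons p₀ p : Fin (k + 1) → V) y) ↔ 0 = y := by
    conv_lhs => lhs; rw [← Fin.cons_zero (α := fun _ => V) p₀ p]
    exact hp.eq_iff
  simp [extMatrix, this]

theorem det_extMatrix_cons {k : ℕ} {p₀ a₀ : V} {p a : Fin k → V} (h₀ : a₀ ≠ p₀)
    (hp : ∀ y, p y ≠ p₀) (ha : ∀ x, a x ≠ a₀) :
    (extMatrix (Fin.cons p₀ p : Fin (k + 1) → V) (Fin.cons a₀ a)).det =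
      (extMatrix p (fun x => swap p₀ a₀ (a x))).det := by
  set B := extMatrix (Fin.cons p₀ p : Fin (k + 1) → V) (Fin.cons a₀ a) with hB
  let A : Matrix (Fin (k + 1)) (Fin (k + 1)) ℝ := Matrix.of fun x y =>
    B x y + (Fin.cons 0 fun y => if a₀ = p y then 1 else 0 : Fin (k + 1) → ℝ) y * B x 0
  have hAB : A.det = B.det := by
    rw [← Matrix.det_transpose A, ← Matrix.det_transpose B]
    exact Matrix.det_eq_of_forall_row_eq_smul_add_const
      (Fin.cons 0 fun y => if a₀ = p y then 1 else 0) 0 (by simp) fun i j => rfl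
  have h00 : A 0 0 = 1 := by simp [A, B, extMatrix, h₀]
  have h0s : ∀ y : Fin k, A 0 y.succ = 0 := by
    intro y
    simp [A, B, extMatrix, h₀, (Fin.succ_ne_zero _).symm]
  rw [← hAB, Matrix.det_succ_row_zero, Fin.sum_univ_succ, h00]
  simp only [h0s]
  simp only [Fin.val_zero, pow_zero, one_mul, mul_zero, zero_mul, sum_const_zero, add_zero,
    Fin.succAbove_zero]
  congr 1
  ext x y
  have key : (if swap p₀ a₀ (a x) = p y then (1 : ℝ) else 0) =
      (if a x = p y then 1 else 0) +
        (if a₀ = p y then 1 else 0) * (if a x = p₀ then 1 else 0) := by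
    by_cases h1 : a x = p₀
    · rw [h1, swap_apply_left]
      simp [(hp y).symm]
    · rw [swap_apply_of_ne_of_ne h1 (ha x)]
      simp [h1]
  simp [A, B, extMatrix, key, Fin.succ_ne_zero]
  ring

end ExtensionMatrix

theorem sum_fin_succ_fun {V M : Type*} [Fintype V] [AddCommMonoid M] {k : ℕ}
    (F : (Fin (k + 1) → V) → M) :
    ∑ a, F a = ∑ x : V, ∑ a : Fin k → V, F (Fin.cons x a) := by
  rw [← Fintype.sum_prod_type']
  exact (Fintype.sum_equiv (Fin.consEquiv fun _ => V) _ _ fun _ => rfl).symm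

section Cycles

variable {V : Type*} [Fintype V] [DecidableEq V]

open Classical in
/-- The permutations that fix every point outside `s` and permute `s` in a single cycle. -/
noncomputable def cyclesOn (s : Finset V) : Finset (Perm V) :=
  {ν : Perm V | (∀ x, x ∉ s → ν x = x) ∧ ∀ x ∈ s, ∀ y ∈ s, SameCycle ν x y}

theorem mem_cyclesOn {s : Finset V} {ν : Perm V} :
    ν ∈ cyclesOn s ↔ (∀ x, x ∉ s → ν x = x) ∧ ∀ x ∈ s, ∀ y ∈ s, SameCycle ν x y := by
  simp [cyclesOn]

theorem apply_mem_of_mem_cyclesOn {s : Finset V} {ν : Perm V} (h : ν ∈ cyclesOn s) {x : V}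
    (hx : x ∈ s) : ν x ∈ s := by
  by_contra hn
  have := (mem_cyclesOn.1 h).1 _ hn
  rw [ν.injective this] at hn
  exact hn hx

theorem apply_ne_of_mem_cyclesOn {s : Finset V} {ν : Perm V} (h : ν ∈ cyclesOn s) {p : V}
    (hp : p ∈ s) (hs : (s.erase p).Nonempty) : ν p ≠ p := by
  obtain ⟨y, hy⟩ := hs
  intro hpp
  obtain ⟨i, hi⟩ := (mem_cyclesOn.1 h).2 p hp y (mem_of_mem_erase hy)
  rw [zpow_apply_eq_self_of_apply_eq_self hpp] at hi
  exact ne_of_mem_erase hy hi.symm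

/-- Inserting a point `p` in front of `a` into a cycle. -/
theorem swap_mul_mem_cyclesOn {s : Finset V} {p a : V} {ν : Perm V} (hp : p ∈ s)
    (ha : a ∈ s.erase p) (h : ν ∈ cyclesOn (s.erase p)) : swap p a * ν ∈ cyclesOn s := by
  have hν := mem_cyclesOn.1 h
  have hνp : ν p = p := hν.1 p (by simp)
  have hfp : (swap p a * ν) p = a := by simp [hνp]
  have step : ∀ x ∈ s.erase p, SameCycle (swap p a * ν) x (ν x) := by
    intro x hx
    have hxs := apply_mem_of_mem_cyclesOn h hx
    by_cases hxa : ν x = a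
    · have h1 : (swap p a * ν) x = p := by simp [hxa]
      refine ⟨2, ?_⟩
      rw [hxa, zpow_ofNat, pow_two, Perm.mul_apply _ _ x, h1, hfp]
    · refine ⟨1, ?_⟩
      rw [zpow_one, Perm.mul_apply, swap_apply_of_ne_of_ne (ne_of_mem_erase hxs) hxa]
  have pows : ∀ k : ℕ, (ν ^ k) a ∈ s.erase p ∧ SameCycle (swap p a * ν) a ((ν ^ k) a) := by
    intro k
    induction k with
    | zero => exact ⟨by simpa using ha, SameCycle.refl _ _⟩
    | succ k ih =>
      rw [pow_succ', Perm.mul_apply]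
      exact ⟨apply_mem_of_mem_cyclesOn h ih.1, ih.2.trans (step _ ih.1)⟩
  have all : ∀ y ∈ s, SameCycle (swap p a * ν) a y := by
    intro y hy
    by_cases hyp : y = p
    · subst hyp
      exact SameCycle.symm ⟨1, by rw [zpow_one, hfp]⟩
    · obtain ⟨k, -, hk⟩ := (hν.2 a ha y (mem_erase.2 ⟨hyp, hy⟩)).exists_pow_eq'
      rw [← hk]
      exact (pows k).2
  refine mem_cyclesOn.2 ⟨fun x hx => ?_, fun x hx y hy => (all x hx).symm.trans (all y hy)⟩
  have h1 : ν x = x := hν.1 x fun hx' => hx (mem_of_mem_erase hx')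
  rw [Perm.mul_apply, h1, swap_apply_of_ne_of_ne]
  · rintro rfl; exact hx hp
  · rintro rfl; exact hx (mem_of_mem_erase ha)

/-- Removing a point `p` from a cycle. -/
theorem swap_mul_mem_cyclesOn_erase {s : Finset V} {p : V} {ν : Perm V} (hp : p ∈ s)
    (h : ν ∈ cyclesOn s) : swap p (ν p) * ν ∈ cyclesOn (s.erase p) := by
  have hν := mem_cyclesOn.1 h
  have aux : ∀ k : ℕ, ∀ x, x ≠ p → (ν ^ k) x ≠ p →
      SameCycle (swap p (ν p) * ν) x ((ν ^ k) x) := by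
    intro k
    induction k using Nat.strong_induction_on with
    | _ k ih =>
      intro x hx hk
      match k, ih, hk with
      | 0, _, _ => exact SameCycle.refl _ _
      | 1, _, hk =>
        rw [pow_one] at hk ⊢
        refine ⟨1, ?_⟩
        rw [zpow_one, Perm.mul_apply, swap_apply_of_ne_of_ne hk fun e => hx (ν.injective e)]
      | k + 2, ih, hk =>
        by_cases h1 : ν x = p
        · have h2 : (swap p (ν p) * ν) x = ν p := by simp [h1]
          have h3 : (ν ^ (k + 2)) x = (ν ^ k) (ν p) := by
            rw [pow_add, Perm.mul_apply, pow_two, Perm.mul_apply, h1]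
          rw [h3] at hk ⊢
          have h4 : ν p ≠ p := fun e => hx (ν.injective (h1.trans e.symm))
          exact SameCycle.trans ⟨1, by rw [zpow_one, h2]⟩ (ih k (by omega) _ h4 hk)
        · have h2 : (swap p (ν p) * ν) x = ν x := by
            rw [Perm.mul_apply, swap_apply_of_ne_of_ne h1 fun e => hx (ν.injective e)]
          have h3 : (ν ^ (k + 2)) x = (ν ^ (k + 1)) (ν x) := by
            rw [pow_succ, Perm.mul_apply]
          rw [h3] at hk ⊢
          exact SameCycle.trans ⟨1, by rw [zpow_one, h2]⟩ (ih (k + 1) (by omega) _ h1 hk)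
  refine mem_cyclesOn.2 ⟨fun x hx => ?_, fun x hx y hy => ?_⟩
  · by_cases hxp : x = p
    · subst hxp; simp
    · have hxs : x ∉ s := fun hx' => hx (mem_erase.2 ⟨hxp, hx'⟩)
      have h1 := hν.1 x hxs
      rw [Perm.mul_apply, h1, swap_apply_of_ne_of_ne hxp]
      rintro rfl
      exact hxs (apply_mem_of_mem_cyclesOn h hp)
  · obtain ⟨k, -, hk⟩ :=
      (hν.2 x (mem_of_mem_erase hx) y (mem_of_mem_erase hy)).exists_pow_eq'
    rw [← hk]
    exact aux k x (ne_of_mem_erase hx) (hk ▸ ne_of_mem_erase hy)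

theorem sum_cyclesOn_eq_sum_erase {M : Type*} [AddCommMonoid M] {s : Finset V} {p : V}
    (hp : p ∈ s) (hs : (s.erase p).Nonempty) (F : Perm V → M) :
    ∑ ν ∈ cyclesOn s, F ν =
      ∑ a ∈ s.erase p, ∑ ν ∈ cyclesOn (s.erase p), F (swap p a * ν) := by
  rw [← sum_product']
  refine (sum_bij' (fun x _ => swap p x.1 * x.2) (fun ν _ => (ν p, swap p (ν p) * ν))
    ?_ ?_ ?_ ?_ ?_).symm
  · rintro ⟨a, ν⟩ h
    rw [mem_product] at h
    exact swap_mul_mem_cyclesOn hp h.1 h.2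
  · intro ν h
    exact mem_product.2 ⟨mem_erase.2 ⟨apply_ne_of_mem_cyclesOn h hp hs,
      apply_mem_of_mem_cyclesOn h hp⟩, swap_mul_mem_cyclesOn_erase hp h⟩
  · rintro ⟨a, ν⟩ h
    rw [mem_product] at h
    have h1 : ν p = p := (mem_cyclesOn.1 h.2).1 p (by simp)
    simp [h1, ← mul_assoc]
  · intro ν h
    simp [← mul_assoc]
  · rintro ⟨a, ν⟩ h
    rfl

theorem card_cyclesOn {s : Finset V} (hs : s.Nonempty) : #(cyclesOn s) = (#s - 1).factorial := by
  induction h : #s generalizing s with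
  | zero => simp [Finset.card_eq_zero] at h; simp [h] at hs
  | succ m ih =>
    obtain ⟨p, hp⟩ := hs
    have hc : #(s.erase p) = m := by rw [card_erase_of_mem hp, h]; rfl
    rcases (s.erase p).eq_empty_or_nonempty with he | hne
    · have hm : m = 0 := by rw [← hc, he]; rfl
      have hs1 : s = {p} := by
        rw [← insert_erase hp, he]
        rfl
      have : cyclesOn s = {1} := by
        ext ν
        rw [mem_cyclesOn, hs1, mem_singleton]
        constructor
        · rintro ⟨h1, -⟩
          have h2 : ν p = p := by
            by_contra hne
            have := h1 (ν p) (by simpa using hne)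
            exact hne (ν.injective this)
          ext x
          by_cases hx : x = p
          · rw [hx, h2]; rfl
          · rw [h1 x (by simpa using hx)]; rfl
        · rintro rfl
          simp
      rw [this, hm]
      rfl
    · have hm : 0 < m := by rw [← hc]; exact hne.card_pos
      rw [card_eq_sum_ones, sum_cyclesOn_eq_sum_erase hp hne]
      simp only [sum_const, smul_eq_mul, mul_one, ih hne hc, hc]
      rw [Nat.mul_factorial_pred hm.ne']
      rfl

/-- The sum over the cycles on `s` of a function of the images of `k` points of `s`. -/
theorem sum_cyclesOn_apply {k : ℕ} {s : Finset V} {p : Fin k → V} (hp : Function.Injective p)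
    (hps : ∀ x, p x ∈ s) (hk : k < #s) (F : (Fin k → V) → ℝ)
    (hF : ∀ a, ¬Function.Injective a → F a = 0) (hFs : ∀ a, (∃ x, a x ∉ s) → F a = 0) :
    ∑ ν ∈ cyclesOn s, F (fun x => ν (p x)) =
      ((#s - k - 1).factorial : ℝ) * ∑ a, F a * (extMatrix p a).det := by
  induction k generalizing s with
  | zero =>
    have hs : s.Nonempty := card_pos.1 hk
    simp [Subsingleton.elim _ p, card_cyclesOn hs]
  | succ k ih =>
    obtain ⟨p₀, p, rfl⟩ : ∃ p₀ q, p = Fin.cons p₀ q :=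
      ⟨p 0, Fin.tail p, (Fin.cons_self_tail p).symm⟩
    have hp₀ : p₀ ∈ s := by simpa using hps 0
    have hpy : ∀ y, p y ≠ p₀ := fun y e => by
      have := hp (a₁ := y.succ) (a₂ := 0) (by simpa using e)
      exact Fin.succ_ne_zero _ this
    have hcard : #(s.erase p₀) = #s - 1 := card_erase_of_mem hp₀
    have hne : (s.erase p₀).Nonempty := card_pos.1 (by omega)
    have hpinj : Function.Injective p := fun x y e => by
      have := hp (a₁ := x.succ) (a₂ := y.succ) (by simpa using e)
      exact Fin.succ_injective _ this
    rw [sum_cyclesOn_eq_sum_erase hp₀ hne, sum_fin_succ_fun, mul_sum,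
      ← sum_subset (subset_univ (s.erase p₀))]
    · refine sum_congr rfl fun a ha => ?_
      have ha' := mem_erase.1 ha
      have step : ∀ ν ∈ cyclesOn (s.erase p₀),
          F (fun x => (swap p₀ a * ν) ((Fin.cons p₀ p : Fin (k + 1) → V) x)) =
            (fun b : Fin k → V => F (Fin.cons a fun x => swap p₀ a (b x)))
              (fun x => ν (p x)) := by
        intro ν hν
        have h1 : ν p₀ = p₀ := (mem_cyclesOn.1 hν).1 p₀ (by simp)
        dsimp only
        congr 1
        ext x
        refine Fin.cases ?_ (fun x => ?_) x <;> simp [h1]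
      rw [sum_congr rfl step]
      refine (ih hpinj (s := s.erase p₀)
        (fun x => mem_erase.2 ⟨hpy x, by simpa using hps x.succ⟩) (by omega)
        (fun b => F (Fin.cons a fun x => swap p₀ a (b x))) ?_ ?_).trans ?_
      · intro b hb
        apply hF
        intro hinj
        apply hb
        intro x y hxy
        have := hinj (a₁ := x.succ) (a₂ := y.succ) (by simp [hxy])
        exact Fin.succ_injective _ this
      · rintro b ⟨x, hx⟩
        by_cases hbx : b x = p₀
        · apply hF
          intro hinj
          have := hinj (a₁ := x.succ) (a₂ := 0) (by simp [hbx])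
          exact Fin.succ_ne_zero _ this
        · have hbs : b x ∉ s := fun h => hx (mem_erase.2 ⟨hbx, h⟩)
          apply hFs
          refine ⟨x.succ, ?_⟩
          rw [Fin.cons_succ, swap_apply_of_ne_of_ne hbx]
          · exact hbs
          · rintro rfl; exact hbs ha'.2
      · rw [hcard, show #s - 1 - k - 1 = #s - (k + 1) - 1 by omega]
        congr 1
        refine Fintype.sum_equiv (Equiv.arrowCongr (Equiv.refl _) (swap p₀ a)) _ _ fun b => ?_
        have e : (Equiv.arrowCongr (Equiv.refl (Fin k)) (swap p₀ a)) b =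
            fun x => swap p₀ a (b x) := rfl
        rw [e]
        by_cases hb : ∀ x, swap p₀ a (b x) ≠ a
        · rw [det_extMatrix_cons ha'.1 hpy hb]
          simp
        · push Not at hb
          obtain ⟨x, hx⟩ := hb
          rw [hF, zero_mul, zero_mul]
          intro hinj
          have := hinj (a₁ := x.succ) (a₂ := 0) (by simpa using hx)
          exact Fin.succ_ne_zero _ this
    · intro a _ ha
      rw [sum_eq_zero, mul_zero]
      intro b _
      by_cases hap : a = p₀
      · subst hap
        rw [det_extMatrix_cons_self hp, mul_zero]
      · rw [hFs, zero_mul]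
        exact ⟨0, fun h => ha (mem_erase.2 ⟨hap, by simpa using h⟩)⟩

end Cycles

section TupleSums

variable {V M : Type*} [Fintype V] [AddCommMonoid M]

theorem sum_fin_zero_fun (F : (Fin 0 → V) → M) : ∑ a, F a = F ![] := by
  rw [Fintype.sum_unique]
  congr 1

theorem sum_fin_two_fun (F : (Fin 2 → V) → M) : ∑ a, F a = ∑ a, ∑ b, F ![a, b] := by
  simp only [sum_fin_succ_fun, sum_fin_zero_fun]
  rfl

theorem sum_fin_three_fun (F : (Fin 3 → V) → M) :
    ∑ a, F a = ∑ a, ∑ b, ∑ c, F ![a, b, c] := by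
  simp only [sum_fin_succ_fun, sum_fin_zero_fun]
  rfl

theorem sum_fin_four_fun (F : (Fin 4 → V) → M) :
    ∑ a, F a = ∑ a, ∑ b, ∑ c, ∑ d, F ![a, b, c, d] := by
  simp only [sum_fin_succ_fun, sum_fin_zero_fun]
  rfl

end TupleSums

theorem det_fin_four {R : Type*} [CommRing R] (A : Matrix (Fin 4) (Fin 4) R) :
    A.det =
      A 0 0 * A 1 1 * A 2 2 * A 3 3 - A 0 0 * A 1 1 * A 2 3 * A 3 2
      - A 0 0 * A 1 2 * A 2 1 * A 3 3 + A 0 0 * A 1 2 * A 2 3 * A 3 1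
      + A 0 0 * A 1 3 * A 2 1 * A 3 2 - A 0 0 * A 1 3 * A 2 2 * A 3 1
      - A 0 1 * A 1 0 * A 2 2 * A 3 3 + A 0 1 * A 1 0 * A 2 3 * A 3 2
      + A 0 1 * A 1 2 * A 2 0 * A 3 3 - A 0 1 * A 1 2 * A 2 3 * A 3 0
      - A 0 1 * A 1 3 * A 2 0 * A 3 2 + A 0 1 * A 1 3 * A 2 2 * A 3 0
      + A 0 2 * A 1 0 * A 2 1 * A 3 3 - A 0 2 * A 1 0 * A 2 3 * A 3 1
      - A 0 2 * A 1 1 * A 2 0 * A 3 3 + A 0 2 * A 1 1 * A 2 3 * A 3 0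
      + A 0 2 * A 1 3 * A 2 0 * A 3 1 - A 0 2 * A 1 3 * A 2 1 * A 3 0
      - A 0 3 * A 1 0 * A 2 1 * A 3 2 + A 0 3 * A 1 0 * A 2 2 * A 3 1
      + A 0 3 * A 1 1 * A 2 0 * A 3 2 - A 0 3 * A 1 1 * A 2 2 * A 3 0
      - A 0 3 * A 1 2 * A 2 0 * A 3 1 + A 0 3 * A 1 2 * A 2 1 * A 3 0 := by
  rw [Matrix.det_succ_row_zero]
  simp only [Fin.sum_univ_four, Matrix.det_fin_three, Matrix.submatrix_apply]
  simp [Fin.succAbove, Fin.lt_def]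
  ring

/-- The Kronecker symbol. -/
def ind {V : Type*} [DecidableEq V] (a b : V) : ℝ := if a = b then 1 else 0

section Kronecker

variable {V : Type*} [DecidableEq V]

theorem ind_of_ne {a b : V} (h : a ≠ b) : ind a b = 0 := if_neg h

theorem ind_self (a : V) : ind a a = 1 := if_pos rfl

theorem extMatrix_apply {k : ℕ} (p a : Fin k → V) (x y : Fin k) :
    extMatrix p a x y = (if x = y then 1 else 0) - ind (a x) (p y) := rfl

theorem extMatrix_update {k : ℕ} (p a : Fin k → V) (i : Fin k) (d : V) :
    extMatrix p (Function.update a i d) = (extMatrix p a).updateRow i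
      fun y => (if i = y then 1 else 0) - ind d (p y) := by
  ext x y
  by_cases h : x = i
  · subst h; simp [extMatrix_apply]
  · simp [extMatrix_apply, h]

theorem det_extMatrix_two (p q a b : V) :
    (extMatrix ![p, q] ![a, b]).det =
      1 - ind a p - ind b q + ind a p * ind b q - ind a q * ind b p := by
  simp only [Matrix.det_fin_two, extMatrix_apply]
  simp
  ring

theorem det_extMatrix_three (p q r a b : V) :
    (extMatrix ![p, q, r] ![a, b, a]).det =
      1 - ind a p - ind a r - ind b q + ind a p * ind b q - ind a q * ind b p
        + ind a r * ind b q - ind a q * ind b r := by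
  simp only [Matrix.det_fin_three, extMatrix_apply]
  simp
  ring

theorem det_extMatrix_four_antisymm (p q r t a b : V) :
    (extMatrix ![p, q, r, t] ![a, b, a, b]).det - (extMatrix ![p, q, r, t] ![a, b, b, a]).det =
      -((extMatrix ![p, q, r, t] ![b, a, b, a]).det
        - (extMatrix ![p, q, r, t] ![b, a, a, b]).det) := by
  simp only [det_fin_four, extMatrix_apply]
  simp
  ring

variable [Fintype V]

theorem sum_mul_ind (f : V → ℝ) (q : V) : ∑ b, f b * ind b q = f q := by
  simp [ind]

theorem sum_mul_det_updateRow {k : ℕ} (p : Fin k → V) (A : Matrix (Fin k) (Fin k) ℝ) (i : Fin k)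
    {w : V → ℝ} (hw : ∑ d, w d = 0) :
    ∑ d, w d * (A.updateRow i fun y => (if i = y then 1 else 0) - ind d (p y)).det =
      (A.updateRow i fun y => -w (p y)).det := by
  have h := (Matrix.detRowAlternating (n := Fin k) (R := ℝ)).toMultilinearMap.map_update_sum
    univ i (fun d y => w d * ((if i = y then 1 else 0) - ind d (p y))) A
  have e : (∑ d, fun y => w d * ((if i = y then (1 : ℝ) else 0) - ind d (p y))) =
      fun y => -w (p y) := by
    ext y
    rw [Finset.sum_apply]
    simp only [mul_sub, sum_sub_distrib, ← sum_mul, hw, zero_mul, zero_sub, sum_mul_ind]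
  rw [e] at h
  refine Eq.trans ?_ h.symm
  refine sum_congr rfl fun d _ => ?_
  rw [← Matrix.det_updateRow_smul]
  rfl

/-- Two free images with proportional weights of sum zero contribute nothing. -/
theorem sum_sum_mul_det_extMatrix_eq_zero {k : ℕ} (p a : Fin k → V) {i j : Fin k} (hij : i ≠ j)
    {w : V → ℝ} (hw : ∑ d, w d = 0) (t : ℝ) :
    ∑ b, ∑ d, w b * (t * w d) *
      (extMatrix p (Function.update (Function.update a i b) j d)).det = 0 := by
  have h1 : ∀ b, ∑ d, w b * (t * w d) *
      (extMatrix p (Function.update (Function.update a i b) j d)).det =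
      t * (w b * (((extMatrix p a).updateRow j fun y => -w (p y)).updateRow i
        fun y => (if i = y then 1 else 0) - ind b (p y)).det) := by
    intro b
    rw [Matrix.updateRow_comm _ hij.symm, ← extMatrix_update, ← sum_mul_det_updateRow p _ j hw]
    simp only [mul_sum, ← extMatrix_update]
    exact sum_congr rfl fun d _ => by ring
  rw [sum_congr rfl fun b _ => h1 b, ← mul_sum, sum_mul_det_updateRow p _ i hw,
    Matrix.det_zero_of_row_eq hij, mul_zero]
  ext y
  simp [Matrix.updateRow_ne hij.symm]

theorem sum_sum_mul_ind_left (g : V → V → ℝ) (p : V) :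
    ∑ a, ∑ b, g a b * ind a p = ∑ b, g p b := by
  simp only [← sum_mul, sum_mul_ind (fun a => ∑ b, g a b)]

theorem sum_sum_mul_ind_right (g : V → V → ℝ) (q : V) :
    ∑ a, ∑ b, g a b * ind b q = ∑ a, g a q := by
  simp only [sum_mul_ind]

theorem sum_sum_mul_ind_mul_ind (g : V → V → ℝ) (p q : V) :
    ∑ a, ∑ b, g a b * (ind a p * ind b q) = g p q := by
  have : ∀ a b, g a b * (ind a p * ind b q) = g a b * ind a p * ind b q := fun a b => by ring
  simp only [this, sum_mul_ind]

end Kronecker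

theorem sum_sum_mul_antisymm {V : Type*} [Fintype V] (g K : V → V → ℝ) (hg : ∀ a b, g a b = g b a)
    (hK : ∀ a b, K a b = -K b a) : ∑ a, ∑ b, g a b * K a b = 0 := by
  have h : ∑ a, ∑ b, g a b * K a b = -∑ a, ∑ b, g a b * K a b := by
    conv_lhs => rw [sum_comm]
    simp only [← sum_neg_distrib]
    refine sum_congr rfl fun a _ => sum_congr rfl fun b _ => ?_
    rw [hg b a, hK b a]; ring
  linarith

theorem kernel_self {V : Type*} {κ : V → V → ℝ} (hκ : ∀ x y, κ x y = -κ y x) (x : V) :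
    κ x x = 0 := by
  have := hκ x x; linarith

theorem sum_kernel_left {V : Type*} [Fintype V] {κ : V → V → ℝ} (hκ : ∀ x y, κ x y = -κ y x)
    (h0 : ∀ x, ∑ y, κ x y = 0) (y : V) : ∑ x, κ x y = 0 := by
  simp only [hκ _ y, sum_neg_distrib, h0, neg_zero]

theorem sum_kernel_sq_left {V : Type*} [Fintype V] {κ : V → V → ℝ}
    (hκ : ∀ x y, κ x y = -κ y x) {H : ℝ} (hH : ∀ x, ∑ y, κ x y ^ 2 = H) (y : V) :
    ∑ x, κ x y ^ 2 = H := by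
  simp only [hκ _ y, neg_sq, hH]

section Kernels

variable {V : Type*} [Fintype V] [DecidableEq V] {κ : V → V → ℝ}

theorem sum_cyclesOn_univ_two {p q : V} (hpq : p ≠ q) (hV : 3 ≤ Fintype.card V)
    (F : V → V → ℝ) (hF : ∀ a, F a a = 0) :
    ∑ ν ∈ cyclesOn (univ : Finset V), F (ν p) (ν q) = ((Fintype.card V - 3).factorial : ℝ) *
      ∑ a, ∑ b, F a b * (1 - ind a p - ind b q + ind a p * ind b q - ind a q * ind b p) := by
  have hinj : Function.Injective ![p, q] := by
    intro x y; fin_cases x <;> fin_cases y <;> simp [hpq, hpq.symm]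
  have := sum_cyclesOn_apply (s := univ) hinj (by simp) (by rw [card_univ]; omega)
    (fun a => F (a 0) (a 1)) (fun a ha => ?_) (by simp)
  · simpa [sum_fin_two_fun, card_univ, Nat.sub_sub, det_extMatrix_two] using this
  · by_contra hne
    apply ha
    intro x y
    have : a 0 ≠ a 1 := fun e => hne (by rw [e, hF])
    fin_cases x <;> fin_cases y <;> simp [this, this.symm]

theorem sum_cyclesOn_kernel {p q : V} (hpq : p ≠ q) (hV : 3 ≤ Fintype.card V)
    (hκ : ∀ x y, κ x y = -κ y x) (h0 : ∀ x, ∑ y, κ x y = 0) :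
    ∑ ν ∈ cyclesOn (univ : Finset V), κ (ν p) (ν q) =
      ((Fintype.card V - 3).factorial : ℝ) * (2 * κ p q) := by
  rw [sum_cyclesOn_univ_two hpq hV κ (kernel_self hκ)]
  simp only [mul_sub, mul_add, mul_one, sum_sub_distrib, sum_add_distrib,
    sum_sum_mul_ind_left κ, sum_sum_mul_ind_right κ, sum_sum_mul_ind_mul_ind κ, h0,
    sum_kernel_left hκ h0, hκ q p, sum_const_zero]
  ring

theorem sum_cyclesOn_kernel_sq {p q : V} (hpq : p ≠ q) (hV : 3 ≤ Fintype.card V)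
    (hκ : ∀ x y, κ x y = -κ y x) {H : ℝ} (hH : ∀ x, ∑ y, κ x y ^ 2 = H) :
    ∑ ν ∈ cyclesOn (univ : Finset V), κ (ν p) (ν q) ^ 2 =
      ((Fintype.card V - 3).factorial : ℝ) * ((Fintype.card V - 2) * H) := by
  rw [sum_cyclesOn_univ_two hpq hV (fun a b => κ a b ^ 2) (by simp [kernel_self hκ])]
  simp only [mul_sub, mul_add, mul_one, sum_sub_distrib, sum_add_distrib,
    sum_sum_mul_ind_left fun a b => κ a b ^ 2, sum_sum_mul_ind_right fun a b => κ a b ^ 2,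
    sum_sum_mul_ind_mul_ind fun a b => κ a b ^ 2, hH, sum_kernel_sq_left hκ hH, hκ q p,
    sum_const, card_univ, nsmul_eq_mul]
  ring

theorem sum_cyclesOn_kernel_mul_kernel_adjacent {p q r : V} (hpq : p ≠ q) (hpr : p ≠ r)
    (hqr : q ≠ r) (hV : 4 ≤ Fintype.card V)
    (hκ : ∀ x y, κ x y = -κ y x) (h0 : ∀ x, ∑ y, κ x y = 0)
    {H : ℝ} (hH : ∀ x, ∑ y, κ x y ^ 2 = H) :
    ∑ ν ∈ cyclesOn (univ : Finset V), κ (ν p) (ν q) * κ (ν q) (ν r) =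
      ((Fintype.card V - 4).factorial : ℝ) * ((Fintype.card V - 3) * H) := by
  have hinj : Function.Injective ![p, q, r] := by
    intro x y
    fin_cases x <;> fin_cases y <;> simp [hpq, hpq.symm, hpr, hpr.symm, hqr, hqr.symm]
  have hs := kernel_self hκ
  have key := sum_cyclesOn_apply (s := univ) hinj (by simp) (by rw [card_univ]; omega)
    (fun a => κ (a 0) (a 1) * κ (a 1) (a 2) * (1 - ind (a 0) (a 2)))
    (fun a ha => ?_) (by simp)
  · have e1 : ∀ ν : Perm V, ind (ν p) (ν r) = 0 := fun ν =>
      ind_of_ne fun e => hpr (ν.injective e)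
    simp only [sum_fin_three_fun, card_univ, Nat.sub_sub] at key
    simp [e1] at key
    rw [key]
    congr 1
    have z : ∑ b, ∑ a, ∑ c, κ a b * κ b c * (extMatrix ![p, q, r] ![a, b, c]).det = 0 := by
      refine sum_eq_zero fun b _ => ?_
      have := sum_sum_mul_det_extMatrix_eq_zero ![p, q, r] ![b, b, b] (i := 0) (j := 2)
        (by simp) (h0 b) (-1)
      rw [← this]
      refine sum_congr rfl fun a _ => sum_congr rfl fun c _ => ?_
      have u : Function.update (Function.update ![b, b, b] 0 a) 2 c = ![a, b, c] := by
        ext x; fin_cases x <;> simp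
      rw [u, hκ a b]; ring
    rw [sum_comm] at z
    have e : ∀ a b c, κ a b * κ b c * (1 - ind a c) * (extMatrix ![p, q, r] ![a, b, c]).det =
        κ a b * κ b c * (extMatrix ![p, q, r] ![a, b, c]).det -
          κ a b * κ b c * (extMatrix ![p, q, r] ![a, b, c]).det * ind c a := by
      intro a b c
      rw [show ind a c = ind c a by simp only [ind, eq_comm]]
      ring
    have e2 : ∀ a b, κ a b * κ b a * (extMatrix ![p, q, r] ![a, b, a]).det =
        -(κ a b ^ 2 * (1 - ind a p - ind a r - ind b q + ind a p * ind b q - ind a q * ind b p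
        + ind a r * ind b q - ind a q * ind b r)) := by
      intro a b
      rw [det_extMatrix_three, hκ b a]; ring
    simp only [e, sum_sub_distrib, z, sum_mul_ind, e2, sum_neg_distrib]
    simp only [mul_sub, mul_add, mul_one, sum_sub_distrib, sum_add_distrib,
      sum_sum_mul_ind_left fun a b => κ a b ^ 2, sum_sum_mul_ind_right fun a b => κ a b ^ 2,
      sum_sum_mul_ind_mul_ind fun a b => κ a b ^ 2, hH, sum_kernel_sq_left hκ hH, hκ q p, hκ q r,
      sum_const, card_univ, nsmul_eq_mul]
    ring
  · by_contra hne
    apply ha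
    have h01 : a 0 ≠ a 1 := fun e => hne (by simp [e, hs])
    have h12 : a 1 ≠ a 2 := fun e => hne (by simp [e, hs])
    have h02 : a 0 ≠ a 2 := fun e => hne (by simp [e, ind_self])
    intro x y
    fin_cases x <;> fin_cases y <;> simp [h01, h01.symm, h12, h12.symm, h02, h02.symm]

theorem sum_sum_kernel_mul_rows (hκ : ∀ x y, κ x y = -κ y x) (h0 : ∀ x, ∑ y, κ x y = 0)
    (s t : ℝ) (u v : V) : ∑ a, ∑ b, κ a b * ((s - ind a u) * (t - ind b v)) = κ u v := by
  have e : ∀ a b, κ a b * ((s - ind a u) * (t - ind b v)) =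
      κ a b * (s * t) - κ a b * ind a u * t - κ a b * ind b v * s
        + κ a b * (ind a u * ind b v) := fun a b => by ring
  simp only [e, sum_add_distrib, sum_sub_distrib, ← sum_mul, sum_sum_mul_ind_mul_ind κ,
    sum_mul_ind (κ _), h0, zero_mul, sum_const_zero, sum_kernel_left hκ h0]
  ring

theorem sum_kernel_mul_kernel_mul_rows (hκ : ∀ x y, κ x y = -κ y x)
    (h0 : ∀ x, ∑ y, κ x y = 0) (s₀ s₁ s₂ s₃ : ℝ) (u₀ u₁ u₂ u₃ : V) :
    ∑ a, ∑ b, ∑ c, ∑ d, κ a b * κ c d *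
        ((s₀ - ind a u₀) * (s₁ - ind b u₁) * (s₂ - ind c u₂) * (s₃ - ind d u₃)) =
      κ u₀ u₁ * κ u₂ u₃ := by
  rw [← sum_sum_kernel_mul_rows hκ h0 s₀ s₁ u₀ u₁, ← sum_sum_kernel_mul_rows hκ h0 s₂ s₃ u₂ u₃]
  simp only [sum_mul]
  simp only [mul_sum]
  refine sum_congr rfl fun a _ => sum_congr rfl fun b _ => sum_congr rfl fun c _ =>
    sum_congr rfl fun d _ => ?_
  ring

theorem sum_kernel_mul_kernel_mul_det (hκ : ∀ x y, κ x y = -κ y x)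
    (h0 : ∀ x, ∑ y, κ x y = 0) (p : Fin 4 → V) :
    ∑ a, ∑ b, ∑ c, ∑ d, κ a b * κ c d * (extMatrix p ![a, b, c, d]).det =
      8 * (κ (p 0) (p 1) * κ (p 2) (p 3) - κ (p 0) (p 2) * κ (p 1) (p 3)
        + κ (p 0) (p 3) * κ (p 1) (p 2)) := by
  have r0 : ∀ a b c d j, extMatrix p ![a, b, c, d] 0 j =
    (if 0 = j then 1 else 0) - ind a (p j) := fun _ _ _ _ _ => rfl
  have r1 : ∀ a b c d j, extMatrix p ![a, b, c, d] 1 j =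
    (if 1 = j then 1 else 0) - ind b (p j) := fun _ _ _ _ _ => rfl
  have r2 : ∀ a b c d j, extMatrix p ![a, b, c, d] 2 j =
    (if 2 = j then 1 else 0) - ind c (p j) := fun _ _ _ _ _ => rfl
  have r3 : ∀ a b c d j, extMatrix p ![a, b, c, d] 3 j =
    (if 3 = j then 1 else 0) - ind d (p j) := fun _ _ _ _ _ => rfl
  simp only [det_fin_four, r0, r1, r2, r3, mul_add (κ _ _ * κ _ _), mul_sub (κ _ _ * κ _ _),
    sum_add_distrib, sum_sub_distrib, sum_kernel_mul_kernel_mul_rows hκ h0]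
  rw [hκ (p 1) (p 0), hκ (p 2) (p 0), hκ (p 3) (p 0), hκ (p 2) (p 1), hκ (p 3) (p 1),
    hκ (p 3) (p 2)]
  ring

theorem sum_cyclesOn_kernel_mul_kernel {p q r t : V} (hpq : p ≠ q) (hpr : p ≠ r) (hpt : p ≠ t)
    (hqr : q ≠ r) (hqt : q ≠ t) (hrt : r ≠ t) (hV : 5 ≤ Fintype.card V)
    (hκ : ∀ x y, κ x y = -κ y x) (h0 : ∀ x, ∑ y, κ x y = 0) :
    ∑ ν ∈ cyclesOn (univ : Finset V), κ (ν p) (ν q) * κ (ν r) (ν t) =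
      ((Fintype.card V - 5).factorial : ℝ) *
        (8 * (κ p q * κ r t - κ p r * κ q t + κ p t * κ q r)) := by
  have hinj : Function.Injective ![p, q, r, t] := by
    intro x y
    fin_cases x <;> fin_cases y <;>
      simp [hpq, hpq.symm, hpr, hpr.symm, hqr, hqr.symm, hpt, hpt.symm, hqt, hqt.symm, hrt,
        hrt.symm]
  have hs := kernel_self hκ
  have key := sum_cyclesOn_apply (s := univ) hinj (by simp) (by rw [card_univ]; omega)
    (fun a => κ (a 0) (a 1) * κ (a 2) (a 3) * (1 - ind (a 2) (a 0) - ind (a 3) (a 0)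
      - ind (a 2) (a 1) - ind (a 3) (a 1) + ind (a 2) (a 0) * ind (a 3) (a 1)
      + ind (a 2) (a 1) * ind (a 3) (a 0)))
    (fun a ha => ?_) (by simp)
  · have e1 : ∀ (ν : Perm V) {x y : V}, x ≠ y → ind (ν y) (ν x) = 0 := fun ν x y hxy =>
      ind_of_ne fun e => hxy (ν.injective e.symm)
    simp only [sum_fin_four_fun, card_univ, Nat.sub_sub] at key
    simp [e1 _ hpr, e1 _ hpt, e1 _ hqr, e1 _ hqt] at key
    rw [key]
    congr 1
    set P := ![p, q, r, t] with hP
    have z := sum_kernel_mul_kernel_mul_det hκ h0 P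
    have zac : ∑ a, ∑ b, ∑ d, κ a b * κ a d * (extMatrix P ![a, b, a, d]).det = 0 := by
      refine sum_eq_zero fun a _ => ?_
      rw [← sum_sum_mul_det_extMatrix_eq_zero P ![a, a, a, a] (i := 1) (j := 3) (by simp)
        (h0 a) 1]
      refine sum_congr rfl fun b _ => sum_congr rfl fun d _ => ?_
      have u : Function.update (Function.update ![a, a, a, a] 1 b) 3 d = ![a, b, a, d] := by
        ext x; fin_cases x <;> simp
      rw [u]; ring
    have zad : ∑ a, ∑ b, ∑ c, κ a b * κ c a * (extMatrix P ![a, b, c, a]).det = 0 := by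
      refine sum_eq_zero fun a _ => ?_
      rw [← sum_sum_mul_det_extMatrix_eq_zero P ![a, a, a, a] (i := 1) (j := 2) (by simp)
        (h0 a) (-1)]
      refine sum_congr rfl fun b _ => sum_congr rfl fun c _ => ?_
      have u : Function.update (Function.update ![a, a, a, a] 1 b) 2 c = ![a, b, c, a] := by
        ext x; fin_cases x <;> simp
      rw [u, hκ c a]; ring
    have zbc : ∑ b, ∑ a, ∑ d, κ a b * κ b d * (extMatrix P ![a, b, b, d]).det = 0 := by
      refine sum_eq_zero fun b _ => ?_
      rw [← sum_sum_mul_det_extMatrix_eq_zero P ![b, b, b, b] (i := 0) (j := 3) (by simp)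
        (h0 b) (-1)]
      refine sum_congr rfl fun a _ => sum_congr rfl fun d _ => ?_
      have u : Function.update (Function.update ![b, b, b, b] 0 a) 3 d = ![a, b, b, d] := by
        ext x; fin_cases x <;> simp
      rw [u, hκ a b]; ring
    have zbd : ∑ b, ∑ a, ∑ c, κ a b * κ c b * (extMatrix P ![a, b, c, b]).det = 0 := by
      refine sum_eq_zero fun b _ => ?_
      rw [← sum_sum_mul_det_extMatrix_eq_zero P ![b, b, b, b] (i := 0) (j := 2) (by simp)
        (h0 b) 1]
      refine sum_congr rfl fun a _ => sum_congr rfl fun c _ => ?_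
      have u : Function.update (Function.update ![b, b, b, b] 0 a) 2 c = ![a, b, c, b] := by
        ext x; fin_cases x <;> simp
      rw [u, hκ a b, hκ c b]; ring
    rw [sum_comm] at zbc zbd
    have z2 : ∑ a, ∑ b, κ a b ^ 2 *
        ((extMatrix P ![a, b, a, b]).det - (extMatrix P ![a, b, b, a]).det) = 0 :=
      sum_sum_mul_antisymm (fun a b => κ a b ^ 2) _ (fun a b => by rw [hκ, neg_sq])
        (fun a b => det_extMatrix_four_antisymm p q r t a b)
    have e : ∀ a b c d, κ a b * κ c d * (1 - ind c a - ind d a - ind c b - ind d b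
        + ind c a * ind d b + ind c b * ind d a) * (extMatrix P ![a, b, c, d]).det =
        κ a b * κ c d * (extMatrix P ![a, b, c, d]).det
        - κ a b * κ c d * (extMatrix P ![a, b, c, d]).det * ind c a
        - κ a b * κ c d * (extMatrix P ![a, b, c, d]).det * ind d a
        - κ a b * κ c d * (extMatrix P ![a, b, c, d]).det * ind c b
        - κ a b * κ c d * (extMatrix P ![a, b, c, d]).det * ind d b
        + κ a b * κ c d * (extMatrix P ![a, b, c, d]).det * (ind c a * ind d b)
        + κ a b * κ c d * (extMatrix P ![a, b, c, d]).det * (ind c b * ind d a) := by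
      intros; ring
    have el : ∀ a b u, ∑ c, ∑ d, κ a b * κ c d * (extMatrix P ![a, b, c, d]).det * ind c u =
        ∑ d, κ a b * κ u d * (extMatrix P ![a, b, u, d]).det := fun a b u =>
      sum_sum_mul_ind_left (fun c d => κ a b * κ c d * (extMatrix P ![a, b, c, d]).det) u
    have er : ∀ a b u, ∑ c, ∑ d, κ a b * κ c d * (extMatrix P ![a, b, c, d]).det * ind d u =
        ∑ c, κ a b * κ c u * (extMatrix P ![a, b, c, u]).det := fun a b u =>
      sum_sum_mul_ind_right (fun c d => κ a b * κ c d * (extMatrix P ![a, b, c, d]).det) u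
    have elr : ∀ a b u v, ∑ c, ∑ d, κ a b * κ c d * (extMatrix P ![a, b, c, d]).det *
        (ind c u * ind d v) = κ a b * κ u v * (extMatrix P ![a, b, u, v]).det := fun a b u v =>
      sum_sum_mul_ind_mul_ind (fun c d => κ a b * κ c d * (extMatrix P ![a, b, c, d]).det) u v
    simp only [e, sum_sub_distrib, sum_add_distrib, el, er, elr, z, zac, zad, zbc, zbd]
    have z3 : ∑ a, ∑ b, κ a b * κ a b * (extMatrix P ![a, b, a, b]).det +
        ∑ a, ∑ b, κ a b * κ b a * (extMatrix P ![a, b, b, a]).det = 0 := by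
      rw [← z2]
      simp only [← sum_add_distrib]
      refine sum_congr rfl fun a _ => sum_congr rfl fun b _ => ?_
      rw [hκ b a]; ring
    simp only [sub_zero, add_assoc, z3, add_zero]
    simp [hP]
  · by_contra hne
    apply ha
    have h01 : a 0 ≠ a 1 := fun e => hne (by simp [e, hs])
    have h23 : a 2 ≠ a 3 := fun e => hne (by simp [e, hs])
    have h02 : a 0 ≠ a 2 := fun e => hne (by
      rw [← e] at h23 ⊢
      simp [ind_self, ind_of_ne h01, ind_of_ne h23.symm])
    have h03 : a 0 ≠ a 3 := fun e => hne (by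
      rw [← e] at h23 ⊢
      simp [ind_self, ind_of_ne h01, ind_of_ne h23])
    have h12 : a 1 ≠ a 2 := fun e => hne (by
      rw [← e] at h23 ⊢
      simp [ind_self, ind_of_ne h01.symm, ind_of_ne h23.symm])
    have h13 : a 1 ≠ a 3 := fun e => hne (by
      rw [← e] at h23 ⊢
      simp [ind_self, ind_of_ne h01.symm, ind_of_ne h23])
    intro x y
    fin_cases x <;> fin_cases y <;> simp [h01, h01.symm, h12, h12.symm, h02, h02.symm, h03,
      h03.symm, h13, h13.symm, h23, h23.symm]

end Kernels

/-- The signed cyclic distance from `a` to `b`, shifted so that it is antisymmetric: the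
representative of `b - a` modulo `n` in `(0, n)`, minus `n / 2`, for `a ≠ b`. -/
noncomputable def cycDist {n : ℕ} (a b : Fin n) : ℝ :=
  if a < b then (b : ℝ) - a - n / 2 else if b < a then (b : ℝ) - a + n / 2 else 0

theorem cycDist_antisymm {n : ℕ} (a b : Fin n) : cycDist a b = -cycDist b a := by
  unfold cycDist
  rcases lt_trichotomy a b with h | h | h
  · simp [h, h.not_gt]; ring
  · simp [h]
  · simp [h, h.not_gt]; ring

theorem cycDist_of_lt {n : ℕ} {a b : Fin n} (h : a < b) : cycDist a b = (b : ℝ) - a - n / 2 :=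
  if_pos h

theorem cycDist_of_gt {n : ℕ} {a b : Fin n} (h : b < a) : cycDist a b = (b : ℝ) - a + n / 2 := by
  rw [cycDist, if_neg h.not_gt, if_pos h]

theorem sum_comp_cycDist {m : ℕ} (a : Fin (m + 1)) (f : ℝ → ℝ) (hf : f 0 = 0) :
    ∑ b, f (cycDist a b) = ∑ j ∈ range m, f ((j : ℝ) + 1 - ((m : ℝ) + 1) / 2) := by
  rw [← Equiv.sum_comp (Equiv.addLeft a), Fin.sum_univ_succ]
  have h0 : cycDist a (a + 0) = 0 := by simp [cycDist]
  rw [Equiv.coe_addLeft, h0, hf, zero_add, ← Fin.sum_univ_eq_sum_range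
    (fun j => f ((j : ℝ) + 1 - ((m : ℝ) + 1) / 2))]
  refine sum_congr rfl fun j _ => ?_
  congr 1
  beta_reduce
  have hj := j.isLt
  have ha := a.isLt
  have hv : ((a + j.succ : Fin (m + 1)) : ℕ) = (a + (j + 1)) % (m + 1) := by
    rw [Fin.val_add, Fin.val_succ]
  by_cases h : (a : ℕ) + (j + 1) < m + 1
  · rw [Nat.mod_eq_of_lt h] at hv
    rw [cycDist_of_lt (Fin.lt_def.2 (by omega)), hv]
    push_cast; ring
  · have hv' : ((a + j.succ : Fin (m + 1)) : ℕ) + (m + 1) = a + (j + 1) := by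
      rw [hv, Nat.mod_eq_sub_mod (by omega), Nat.mod_eq_of_lt (by omega)]
      omega
    have hr : (((a + j.succ : Fin (m + 1)) : ℕ) : ℝ) + (m + 1) = a + (j + 1) := by
      exact_mod_cast hv'
    rw [cycDist_of_gt (Fin.lt_def.2 (by omega)), eq_sub_of_add_eq hr]
    push_cast; ring

theorem sum_cycDist {n : ℕ} (a : Fin n) : ∑ b, cycDist a b = 0 := by
  obtain ⟨m, rfl⟩ : ∃ m, n = m + 1 := ⟨n - 1, by have := a.isLt; omega⟩
  rw [sum_comp_cycDist a (fun x => x) rfl]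
  have : ∀ (k : ℕ) (c : ℝ), ∑ j ∈ range k, ((j : ℝ) + 1 - c) = k * (k + 1) / 2 - k * c := by
    intro k c
    induction k with
    | zero => simp
    | succ k ih => rw [sum_range_succ, ih]; push_cast; ring
  rw [this]; ring

theorem sum_cycDist_sq {n : ℕ} (a : Fin n) :
    ∑ b, cycDist a b ^ 2 = (n : ℝ) * (n - 1) * (n - 2) / 12 := by
  obtain ⟨m, rfl⟩ : ∃ m, n = m + 1 := ⟨n - 1, by have := a.isLt; omega⟩
  rw [sum_comp_cycDist a (fun x => x ^ 2) (by norm_num)]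
  have : ∀ (k : ℕ) (c : ℝ), ∑ j ∈ range k, ((j : ℝ) + 1 - c) ^ 2 =
      k * (k + 1) * (2 * k + 1) / 6 - c * (k * (k + 1)) + k * c ^ 2 := by
    intro k c
    induction k with
    | zero => simp
    | succ k ih => rw [sum_range_succ, ih]; push_cast; ring
  rw [this]; push_cast; ring

theorem val_finRotate {n : ℕ} (i : Fin n) :
    ((i : ℕ) + 1 < n ∧ (finRotate n i : ℕ) = i + 1) ∨
      ((i : ℕ) + 1 = n ∧ (finRotate n i : ℕ) = 0) := by
  obtain ⟨m, rfl⟩ : ∃ m, n = m + 1 := ⟨n - 1, by have := i.isLt; omega⟩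
  by_cases h : i = Fin.last m
  · right; subst h; simp
  · left
    rw [coe_finRotate_of_ne_last h]
    have : (i : ℕ) ≠ m := fun e => h (Fin.ext e)
    have := i.isLt
    omega

theorem finRotate_ne_self {n : ℕ} (hn : 2 ≤ n) (i : Fin n) : finRotate n i ≠ i := by
  intro h
  have := congrArg Fin.val h
  rcases val_finRotate i with h | h <;> omega

theorem finRotate_finRotate_ne_self {n : ℕ} (hn : 3 ≤ n) (i : Fin n) :
    finRotate n (finRotate n i) ≠ i := by
  intro h
  have := congrArg Fin.val h
  rcases val_finRotate i with h | h <;> rcases val_finRotate (finRotate n i) with h' | h' <;> omega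

theorem cycDist_finRotate {n : ℕ} (hn : 2 ≤ n) (i : Fin n) :
    cycDist i (finRotate n i) = 1 - (n : ℝ) / 2 := by
  rcases val_finRotate i with ⟨h1, h2⟩ | ⟨h1, h2⟩
  · rw [cycDist_of_lt (Fin.lt_def.2 (by omega)), h2]; push_cast; ring
  · rw [cycDist_of_gt (Fin.lt_def.2 (by omega)), h2]
    have : (n : ℝ) = i + 1 := by exact_mod_cast h1.symm
    rw [this]; push_cast; ring

theorem cycDist_eq {n : ℕ} {a b : Fin n} (h : a ≠ b) :
    cycDist a b = (b : ℝ) - a - n / 2 + n * (if a > b then 1 else 0) := by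
  rcases lt_or_gt_of_ne h with h | h
  · rw [cycDist_of_lt h, if_neg h.not_gt]; ring
  · rw [cycDist_of_gt h, if_pos h]; ring

theorem sum_cycDist_apply {n : ℕ} (hn : 2 ≤ n) (ν : Perm (Fin n)) :
    ∑ i, cycDist (ν i) (ν (finRotate n i)) = n * ((degree ν : ℝ) - n / 2) := by
  have h : ∀ i, ν i ≠ ν (finRotate n i) := fun i e =>
    finRotate_ne_self hn i (ν.injective e.symm)
  have e1 : ∑ i, (((ν (finRotate n i) : Fin n) : ℕ) : ℝ) = ∑ i, ((ν i : ℕ) : ℝ) :=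
    Equiv.sum_comp (finRotate n) fun i => ((ν i : ℕ) : ℝ)
  simp only [cycDist_eq (h _), sum_add_distrib, sum_sub_distrib, e1, ← mul_sum, degree]
  simp
  ring

theorem cycDist_pfaffian_of_lt {n : ℕ} {i j : Fin n} (hij : i < j)
    (h1 : j ≠ finRotate n i) (h2 : i ≠ finRotate n j) :
    cycDist i (finRotate n i) * cycDist j (finRotate n j)
      - cycDist i j * cycDist (finRotate n i) (finRotate n j)
      + cycDist i (finRotate n j) * cycDist (finRotate n i) j = (n : ℝ) * (n - 4) / 4 := by
  have hn : 2 ≤ n := by have := j.isLt; have := Fin.lt_def.1 hij; omega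
  have h1' : (j : ℕ) ≠ finRotate n i := fun e => h1 (Fin.ext e)
  have h2' : (i : ℕ) ≠ finRotate n j := fun e => h2 (Fin.ext e)
  have hij' := Fin.lt_def.1 hij
  have hj := j.isLt
  rw [cycDist_finRotate hn, cycDist_finRotate hn, cycDist_of_lt hij]
  rcases val_finRotate i with ⟨a1, a2⟩ | ⟨a1, a2⟩
  · rw [cycDist_of_lt (a := finRotate n i) (b := j) (Fin.lt_def.2 (by omega)), a2]
    rcases val_finRotate j with ⟨b1, b2⟩ | ⟨b1, b2⟩
    · rw [cycDist_of_lt (Fin.lt_def.2 (by omega)), cycDist_of_lt (Fin.lt_def.2 (by omega)), b2, a2]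
      push_cast; ring
    · rw [cycDist_of_gt (Fin.lt_def.2 (by omega)), cycDist_of_gt (Fin.lt_def.2 (by omega)), b2, a2]
      have : (n : ℝ) = j + 1 := by exact_mod_cast b1.symm
      rw [this]
      push_cast; ring
  · omega

theorem cycDist_pfaffian {n : ℕ} {i j : Fin n} (hij : i ≠ j)
    (h1 : j ≠ finRotate n i) (h2 : i ≠ finRotate n j) :
    cycDist i (finRotate n i) * cycDist j (finRotate n j)
      - cycDist i j * cycDist (finRotate n i) (finRotate n j)
      + cycDist i (finRotate n j) * cycDist (finRotate n i) j = (n : ℝ) * (n - 4) / 4 := by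
  rcases lt_or_gt_of_ne hij with h | h
  · exact cycDist_pfaffian_of_lt h h1 h2
  · rw [← cycDist_pfaffian_of_lt h h2 h1, cycDist_antisymm i j,
      cycDist_antisymm (finRotate n i) (finRotate n j), cycDist_antisymm i (finRotate n j),
      cycDist_antisymm (finRotate n i) j]
    ring

theorem nCycles_eq_cyclesOn {n : ℕ} (hn : 2 ≤ n) : nCycles n = cyclesOn univ := by
  have : Nontrivial (Fin n) := Fin.nontrivial_iff_two_le.2 hn
  ext ν
  rw [mem_cyclesOn]
  simp only [nCycles, mem_filter, mem_univ, true_and, not_true_eq_false, false_implies,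
    implies_true, forall_const]
  constructor
  · rintro ⟨hc, hs⟩ x y
    have hm : ∀ z, ν z ≠ z := fun z => mem_support.1 (hs ▸ mem_univ z)
    exact hc.sameCycle (hm x) (hm y)
  · intro h
    have hm : ∀ z, ν z ≠ z := by
      intro z hz
      obtain ⟨y, hy⟩ := exists_ne z
      obtain ⟨i, hi⟩ := h z y
      rw [zpow_apply_eq_self_of_apply_eq_self hz] at hi
      exact hy hi.symm
    refine ⟨⟨⟨0, by omega⟩, hm _, fun y _ => h _ y⟩, ?_⟩
    ext z; simp [hm z]

theorem card_nCycles {n : ℕ} (hn : 2 ≤ n) : #(nCycles n) = (n - 1).factorial := by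
  have : Nonempty (Fin n) := ⟨⟨0, by omega⟩⟩
  rw [nCycles_eq_cyclesOn hn, card_cyclesOn univ_nonempty, card_univ, Fintype.card_fin]

theorem sum_nCycles_degree_sub {n : ℕ} (hn : 3 ≤ n) :
    ∑ ν ∈ nCycles n, ((degree ν : ℝ) - n / 2) = -((n - 2).factorial : ℝ) := by
  have hn0 : (n : ℝ) ≠ 0 := by positivity
  apply mul_left_cancel₀ hn0
  rw [mul_sum]
  simp only [← sum_cycDist_apply (show 2 ≤ n by omega)]
  rw [sum_comm, nCycles_eq_cyclesOn (by omega)]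
  have h : ∀ i : Fin n, ∑ ν ∈ cyclesOn univ, cycDist (ν i) (ν (finRotate n i)) =
      ((n - 3).factorial : ℝ) * (2 * (1 - (n : ℝ) / 2)) := by
    intro i
    rw [sum_cyclesOn_kernel (finRotate_ne_self (by omega) i).symm (by simpa using hn)
      cycDist_antisymm sum_cycDist, cycDist_finRotate (by omega), Fintype.card_fin]
  obtain ⟨m, rfl⟩ : ∃ m, n = m + 3 := ⟨n - 3, by omega⟩
  simp only [h, sum_const, card_univ, Fintype.card_fin, nsmul_eq_mul,
    show m + 3 - 3 = m by omega, show m + 3 - 2 = m + 1 by omega, Nat.factorial_succ]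
  push_cast
  ring

theorem sum_nCycles_degree_sub_sq {n : ℕ} (hn : 5 ≤ n) :
    ∑ ν ∈ nCycles n, ((degree ν : ℝ) - n / 2) ^ 2 =
      ((n - 1).factorial : ℝ) * n / 12 + 2 * ((n - 3).factorial : ℝ) := by
  have hn0 : (n : ℝ) ^ 2 ≠ 0 := by positivity
  apply mul_left_cancel₀ hn0
  rw [mul_sum]
  simp only [← mul_pow, ← sum_cycDist_apply (show 2 ≤ n by omega)]
  simp only [pow_two (∑ i, _), sum_mul_sum]
  rw [sum_comm, nCycles_eq_cyclesOn (by omega)]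
  simp only [sum_comm (s := cyclesOn univ)]
  set H : ℝ := (n : ℝ) * (n - 1) * (n - 2) / 12 with hH
  obtain ⟨m, hm⟩ : ∃ m, n = m + 5 := ⟨n - 5, by omega⟩
  have hcard : Fintype.card (Fin n) = m + 5 := by rw [Fintype.card_fin, hm]
  have hself : ∀ i : Fin n, ∑ ν ∈ cyclesOn univ, cycDist (ν i) (ν (finRotate n i)) *
      cycDist (ν i) (ν (finRotate n i)) = ((m + 2).factorial : ℝ) * ((n - 2) * H) := by
    intro i
    simp only [← pow_two]
    rw [sum_cyclesOn_kernel_sq (finRotate_ne_self (by omega) i).symm (by omega)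
      cycDist_antisymm sum_cycDist_sq, hcard, ← hH, hm]
    rfl
  have hnext : ∀ i : Fin n, ∑ ν ∈ cyclesOn univ, cycDist (ν i) (ν (finRotate n i)) *
      cycDist (ν (finRotate n i)) (ν (finRotate n (finRotate n i))) =
        ((m + 1).factorial : ℝ) * ((n - 3) * H) := by
    intro i
    rw [sum_cyclesOn_kernel_mul_kernel_adjacent (finRotate_ne_self (by omega) i).symm
      (finRotate_finRotate_ne_self (by omega) i).symm
      (finRotate_ne_self (by omega) _).symm (by omega)
      cycDist_antisymm sum_cycDist sum_cycDist_sq, hcard, ← hH, hm]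
    rfl
  have hfar : ∀ i j : Fin n, i ≠ j → j ≠ finRotate n i → i ≠ finRotate n j →
      ∑ ν ∈ cyclesOn univ, cycDist (ν i) (ν (finRotate n i)) *
        cycDist (ν j) (ν (finRotate n j)) = (m.factorial : ℝ) * (2 * n * (n - 4)) := by
    intro i j h1 h2 h3
    rw [sum_cyclesOn_kernel_mul_kernel (finRotate_ne_self (by omega) i).symm h1 h3 h2.symm
      (fun e => h1 ((finRotate n).injective e)) (finRotate_ne_self (by omega) j).symm (by omega)
      cycDist_antisymm sum_cycDist, cycDist_pfaffian h1 h2 h3, hcard,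
      show m + 5 - 5 = m by omega]
    ring
  have hrow : ∀ i : Fin n, ∑ j : Fin n, ∑ ν ∈ cyclesOn univ,
      cycDist (ν i) (ν (finRotate n i)) * cycDist (ν j) (ν (finRotate n j)) =
      ((m + 2).factorial : ℝ) * ((n - 2) * H) + 2 * (((m + 1).factorial : ℝ) * ((n - 3) * H))
        + (n - 3) * ((m.factorial : ℝ) * (2 * n * (n - 4))) := by
    intro i
    set k := (finRotate n).symm i with hk
    have hki : finRotate n k = i := Equiv.apply_symm_apply _ _
    have d1 : i ≠ finRotate n i := (finRotate_ne_self (by omega) i).symm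
    have d2 : i ≠ k := by
      intro e; rw [← e] at hki; exact d1 hki.symm
    have d3 : finRotate n i ≠ k := by
      intro e; rw [← e] at hki; exact finRotate_finRotate_ne_self (by omega) i hki
    have hprev : ∑ ν ∈ cyclesOn univ, cycDist (ν i) (ν (finRotate n i)) *
        cycDist (ν k) (ν (finRotate n k)) = ((m + 1).factorial : ℝ) * ((n - 3) * H) := by
      rw [← hnext k, hki]
      exact sum_congr rfl fun ν _ => mul_comm _ _
    have hi : i ∉ ({finRotate n i, k} : Finset (Fin n)) := by
      rw [mem_insert, mem_singleton, not_or]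
      exact ⟨d1, d2⟩
    have hc : #({i, finRotate n i, k} : Finset (Fin n)) = 3 := by
      rw [card_insert_of_notMem hi, card_pair d3]
    rw [← sum_add_sum_compl {i, finRotate n i, k}, sum_insert hi, sum_pair d3,
      hself, hnext, hprev, sum_congr rfl fun j hj => hfar i j ?_ ?_ ?_, sum_const,
      card_compl, hc, hcard, nsmul_eq_mul, show m + 5 - 3 = m + 2 by omega, hm]
    · push_cast; ring
    all_goals
      simp only [mem_compl, mem_insert, mem_singleton, not_or] at hj
    · exact fun e => hj.1 e.symm
    · exact hj.2.1
    · intro e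
      apply hj.2.2
      rw [hk, e, Equiv.symm_apply_apply]
  rw [sum_congr rfl fun i _ => hrow i, sum_const, card_univ, Fintype.card_fin, nsmul_eq_mul, hH,
    hm, show m + 5 - 1 = m + 4 by omega, show m + 5 - 3 = m + 2 by omega]
  simp only [Nat.factorial_succ]
  push_cast
  ring

theorem one_le_degree {n : ℕ} (hn : 2 ≤ n) (ν : Perm (Fin n)) : 1 ≤ degree ν := by
  obtain ⟨m, rfl⟩ : ∃ m, n = m + 1 := ⟨n - 1, by omega⟩
  refine card_pos.2 ⟨ν.symm (Fin.last m), ?_⟩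
  simp only [mem_filter, mem_univ, true_and, Equiv.apply_symm_apply]
  refine lt_of_le_of_ne (Fin.le_last _) fun e => ?_
  refine finRotate_ne_self hn (ν.symm (Fin.last m)) ?_
  apply ν.injective
  rw [e, Equiv.apply_symm_apply]

theorem cycDist_le {n : ℕ} (hn : 2 ≤ n) (a b : Fin n) : cycDist a b ≤ n / 2 - 1 := by
  have hn' : (2 : ℝ) ≤ n := by exact_mod_cast hn
  rcases lt_trichotomy a b with h | h | h
  · rw [cycDist_of_lt h]
    have : (b : ℝ) + 1 ≤ n := by exact_mod_cast b.isLt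
    have : (0 : ℝ) ≤ a := by positivity
    linarith
  · rw [h, kernel_self cycDist_antisymm]; linarith
  · rw [cycDist_of_gt h]
    have : (b : ℝ) + 1 ≤ a := by exact_mod_cast Fin.lt_def.1 h
    linarith

theorem finRotate_eq_of_cycDist_eq {n : ℕ} (hn : 3 ≤ n) {a b : Fin n}
    (h : cycDist a b = n / 2 - 1) : finRotate n b = a := by
  have hn' : (3 : ℝ) ≤ n := by exact_mod_cast hn
  apply Fin.ext
  rcases lt_trichotomy a b with hab | hab | hab
  · rw [cycDist_of_lt hab] at h
    have h' : (b : ℝ) + 1 = n + a := by linarith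
    have h'' : (b : ℕ) + 1 = n + a := by exact_mod_cast h'
    have := b.isLt
    rcases val_finRotate b with h | h <;> omega
  · rw [hab, kernel_self cycDist_antisymm] at h; linarith
  · rw [cycDist_of_gt hab] at h
    have h' : (b : ℝ) + 1 = a := by linarith
    have h'' : (b : ℕ) + 1 = a := by exact_mod_cast h'
    have := a.isLt
    rcases val_finRotate b with h | h <;> omega

/-- A permutation that turns rotation by one step into rotation by minus one step is a reflection
and therefore an involution. -/
theorem sq_eq_one_of_finRotate_apply {n : ℕ} {ν : Perm (Fin n)}
    (h : ∀ i, finRotate n (ν (finRotate n i)) = ν i) : ν ^ 2 = 1 := by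
  rcases Nat.eq_zero_or_pos n with rfl | hn
  · exact Subsingleton.elim _ _
  have step : ∀ k (hk : k < n), (ν ⟨k, hk⟩ : ℕ) + k ≡ ν ⟨0, hn⟩ [MOD n] := by
    intro k
    induction k with
    | zero => intro _; rfl
    | succ k ih =>
      intro hk
      have hk' : k < n := by omega
      have hr : finRotate n ⟨k, hk'⟩ = ⟨k + 1, hk⟩ := by
        apply Fin.ext
        rcases val_finRotate ⟨k, hk'⟩ with h | h <;> simp only at h ⊢ <;> omega
      have h1 := h ⟨k, hk'⟩
      rw [hr] at h1
      refine Nat.ModEq.trans ?_ (ih hk')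
      rcases val_finRotate (ν ⟨k + 1, hk⟩) with ⟨-, h2⟩ | ⟨h2, h3⟩
      · rw [h1] at h2
        rw [h2, add_assoc, add_comm 1 k]
      · rw [h1] at h3
        rw [h3, ← add_assoc, add_right_comm, h2]
        simp [Nat.ModEq]
  have key : ∀ x, ν (ν x) = x := by
    intro x
    have e1 := step x x.isLt
    have e2 := step (ν x) (ν x).isLt
    have e3 := e2.trans e1.symm
    rw [add_comm _ (x : ℕ)] at e3
    have e4 := Nat.ModEq.add_right_cancel' _ e3
    exact Fin.ext (Nat.ModEq.eq_of_lt_of_lt e4 (ν (ν x)).isLt x.isLt)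
  ext x
  rw [pow_two, Perm.mul_apply, key]
  rfl

theorem degree_le_of_mem_nCycles {n : ℕ} (hn : 3 ≤ n) {ν : Perm (Fin n)} (hν : ν ∈ nCycles n) :
    degree ν ≤ n - 2 := by
  by_contra hlt
  have hge : (n : ℝ) ≤ degree ν + 1 := by
    have : n ≤ degree ν + 1 := by omega
    exact_mod_cast this
  have hsum := sum_cycDist_apply (show 2 ≤ n by omega) ν
  have hall : ∀ i ∈ univ, cycDist (ν i) (ν (finRotate n i)) = n / 2 - 1 := by
    refine (sum_eq_sum_iff_of_le fun i _ => cycDist_le (by omega) _ _).1 (le_antisymm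
      (sum_le_sum fun i _ => cycDist_le (by omega) _ _) ?_)
    rw [hsum, sum_const, card_univ, Fintype.card_fin, nsmul_eq_mul]
    refine mul_le_mul_of_nonneg_left ?_ (by positivity)
    linarith
  have hsq := sq_eq_one_of_finRotate_apply (ν := ν) fun i =>
    finRotate_eq_of_cycDist_eq hn (hall i (mem_univ i))
  simp only [nCycles, mem_filter, mem_univ, true_and] at hν
  have hord := hν.1.orderOf
  rw [hν.2, card_univ, Fintype.card_fin] at hord
  have := Nat.le_of_dvd (by norm_num) (orderOf_dvd_of_pow_eq_one hsq)
  omega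

theorem sum_Icc_mul_N {n : ℕ} (hn : 3 ≤ n) (f : ℕ → ℝ) :
    ∑ d ∈ Icc 1 (n - 2), f d * (N n d : ℝ) = ∑ ν ∈ nCycles n, f (degree ν) := by
  rw [← sum_fiberwise_of_maps_to (g := degree) (t := Icc 1 (n - 2))
    fun ν hν => mem_Icc.2 ⟨one_le_degree (by omega) ν, degree_le_of_mem_nCycles hn hν⟩]
  refine sum_congr rfl fun d _ => ?_
  rw [sum_congr rfl fun ν hν => by rw [(mem_filter.1 hν).2], sum_const, nsmul_eq_mul, mul_comm]
  rfl

theorem integral_uniformCycle {n : ℕ} (hn : 2 ≤ n) (f : Perm (Fin n) → ℝ) :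
    ∫ ν, f ν ∂(uniformCycle n) = 1 / ((n - 1).factorial : ℝ) * ∑ ν ∈ nCycles n, f ν := by
  have : MeasurableSingletonClass (Perm (Fin n)) := ⟨fun _ => trivial⟩
  rw [uniformCycle, ProbabilityTheory.uniformOn, ProbabilityTheory.cond,
    MeasureTheory.integral_smul_measure,
    MeasureTheory.setIntegral_finset _ (.of_finite (finite_toSet _)),
    MeasureTheory.Measure.count_apply_finset, card_nCycles hn]
  simp

theorem meanDegree_eq {n : ℕ} (hn : 3 ≤ n) :
    meanDegree n = (n : ℝ) / 2 - 1 / ((n : ℝ) - 1) := by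
  have h := sum_nCycles_degree_sub hn
  rw [sum_sub_distrib, sum_const, card_nCycles (by omega), nsmul_eq_mul] at h
  rw [meanDegree, sum_Icc_mul_N hn (fun d => (d : ℝ)), eq_add_of_sub_eq h]
  obtain ⟨m, rfl⟩ : ∃ m, n = m + 3 := ⟨n - 3, by omega⟩
  have hf : (m.factorial : ℝ) ≠ 0 := by positivity
  simp only [show m + 3 - 1 = m + 2 by omega, show m + 3 - 2 = m + 1 by omega,
    Nat.factorial_succ]
  push_cast
  rw [show (m : ℝ) + 3 - 1 = m + 2 by ring]
  field_simp
  ring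

theorem varDegree_eq {n : ℕ} (hn : 5 ≤ n) :
    varDegree n = (n : ℝ) / 12 + (n : ℝ) / (((n : ℝ) - 1) ^ 2 * ((n : ℝ) - 2)) := by
  rw [varDegree, sum_Icc_mul_N (by omega) (fun d => ((d : ℝ) - meanDegree n) ^ 2),
    meanDegree_eq (by omega)]
  have e : ∀ ν : Perm (Fin n), ((degree ν : ℝ) - ((n : ℝ) / 2 - 1 / ((n : ℝ) - 1))) ^ 2 =
      ((degree ν : ℝ) - n / 2) ^ 2 + 2 / ((n : ℝ) - 1) * ((degree ν : ℝ) - n / 2)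
        + (1 / ((n : ℝ) - 1)) ^ 2 := fun ν => by ring
  simp only [e, sum_add_distrib, ← mul_sum]
  rw [sum_nCycles_degree_sub_sq hn, sum_nCycles_degree_sub (by omega), sum_const,
    card_nCycles (by omega), nsmul_eq_mul]
  obtain ⟨m, rfl⟩ : ∃ m, n = m + 3 := ⟨n - 3, by omega⟩
  have hf : (m.factorial : ℝ) ≠ 0 := by positivity
  simp only [show m + 3 - 1 = m + 2 by omega, show m + 3 - 2 = m + 1 by omega,
    show m + 3 - 3 = m by omega, Nat.factorial_succ]
  push_cast
  rw [show (m : ℝ) + 3 - 1 = m + 2 by ring, show (m : ℝ) + 3 - 2 = m + 1 by ring]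
  field_simp
  ring

theorem integral_degree_eq_meanDegree {n : ℕ} (hn : 3 ≤ n) :
    ∫ ν, (degree ν : ℝ) ∂(uniformCycle n) = meanDegree n := by
  rw [integral_uniformCycle (by omega), meanDegree, sum_Icc_mul_N hn (fun d => (d : ℝ))]

theorem variance_degree_eq_varDegree {n : ℕ} (hn : 3 ≤ n) :
    ProbabilityTheory.variance (fun ν => (degree ν : ℝ)) (uniformCycle n) = varDegree n := by
  have hm : Measurable (fun ν : Perm (Fin n) => (degree ν : ℝ)) := fun _ _ => trivial
  rw [ProbabilityTheory.variance_eq_integral hm.aemeasurable, integral_degree_eq_meanDegree hn,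
    integral_uniformCycle (by omega), varDegree,
    sum_Icc_mul_N hn (fun d => ((d : ℝ) - meanDegree n) ^ 2)]

end CycleDegree

theorem mainTheorem2 (n : ℕ) :
    (3 ≤ n →
      ∫ ν, (CycleDegree.degree ν : ℝ) ∂(CycleDegree.uniformCycle n) = CycleDegree.meanDegree n ∧
      CycleDegree.meanDegree n = (n : ℝ) / 2 - 1 / ((n : ℝ) - 1)) ∧
    (5 ≤ n →
      ProbabilityTheory.variance (fun ν => (CycleDegree.degree ν : ℝ))
          (CycleDegree.uniformCycle n) = CycleDegree.varDegree n ∧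
      CycleDegree.varDegree n =
        (n : ℝ) / 12 + (n : ℝ) / (((n : ℝ) - 1) ^ 2 * ((n : ℝ) - 2))) :=
  ⟨fun hn => ⟨CycleDegree.integral_degree_eq_meanDegree hn, CycleDegree.meanDegree_eq hn⟩,
    fun hn => ⟨CycleDegree.variance_degree_eq_varDegree (by omega), CycleDegree.varDegree_eq hn⟩⟩
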